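/- Let $p>1$, let $N\in\mathbb N$ with $N>p$, let $\Omega\subset\mathbb R^N$ be a bounded domain (nonempty, open and connected), and let $p^*=\frac{pN}{N-p}$. Let $M$ be a real function that is continuous on $(0,\infty)$ and integrable near $0$, and put $\widehat M(t)=\int_0^tM(s)\,ds$ for $t\ge0$. Let $f:\Omega\times\mathbb R\to\mathbb R$ be such that $f(x,\cdot)$ is locally integrable for every $x\in\Omega$, put $F(x,v)=\int_0^vf(x,s)\,ds$, and assume that $F(\cdot,v)$ is measurable on $\Omega$ for every $v\in\mathbb R$ and that, for some constant $C_0>0$, $$F(x,v)\le C_0\,(1+|v|^{p^*})\qquad\text{for all }x\in\Omega,\ v\in\mathbb R .$$ Let $W_0^{1,p}(\Omega)$ be the closure of $C_c^\infty(\Omega)$ in the Sobolev space $W^{1,p}(\Omega)$, let $\|u\|_W=\left(\int_\Omega|\nabla u|^p\,dx\right)^{1/p}$, and consider the functional $$J(u)=\frac1p\widehat M(\|u\|_W^p)-\int_\Omega F(x,u(x))\,dx\in(-\infty,+\infty],\qquad u\in W_0^{1,p}(\Omega).$$ Let $r>p^*\ge\varpi>q\ge1$ and assume that for suitable constants $C_1,C_2,C_3>0$: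 - $\frac1p\widehat M(s^p)\le C_1s^r$ for all sufficiently small $s\ge0$; - $F(x,v)\ge C_2v^{\varpi}-C_3v^q$ for all $x\in\Omega$ and $v\ge0$. Then: 1. There exists a sequence $(u_n)$ in $W_0^{1,p}(\Omega)$ with $\|u_n\|_W\to0$ and $J(u_n)<0$ for every $n$. 2. If moreover $\widehat M(t)\ge0$ for all sufficiently small $t\ge0$, and there is $\delta_0>0$ such that $F(x,v)\le0$ for all $x\in\Omega$ and $|v|<\delta_0$, then the origin is a local minimum of $J$ with respect to the $C^1$ norm, but not with respect to the $W_0^{1,p}$ norm. That is, there is $\delta>0$ such that $J(u)\ge J(0)$ for every $u\in C^1(\Omega)\cap W_0^{1,p}(\Omega)$ with $\sup_\Omega|u|+\sup_\Omega|\nabla u|<\delta$, but there is no $\delta>0$ such that $J(u)\ge J(0)$ for every $u\in W_0^{1,p}(\Omega)$ with $\|u\|_W<\delta$. 3. If, in addition to the assumptions in 2, $\widehat M(t)\ge0$ for every $t\ge0$, then the origin is a local minimum of $J$ with respect to both the $C^1$ norm and the $L^\infty$ norm (the latter meaning that there is $\delta>0$ such that $J(u)\ge J(0)$ for every $u\in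 W_0^{1,p}(\Omega)$ with $\|u\|_{L^\infty(\Omega)}<\delta$), but not with respect to the $W_0^{1,p}$ norm. -/

import Mathlib

open Set Filter Topology MeasureTheory
open scoped ENNReal ContDiff

noncomputable section

/-- Smooth functions on `ℝ^N` whose (compact) support is contained in `Ω`. -/
def IsTestFunction {N : ℕ} (Ω : Set (EuclideanSpace ℝ (Fin N)))
    (φ : EuclideanSpace ℝ (Fin N) → ℝ) : Prop :=
  ContDiff ℝ ∞ φ ∧ HasCompactSupport φ ∧ tsupport φ ⊆ Ω

/-- `g` is the weak (distributional) gradient of `u` on `Ω`. -/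
def HasWeakGradient {N : ℕ} (Ω : Set (EuclideanSpace ℝ (Fin N)))
    (u : EuclideanSpace ℝ (Fin N) → ℝ)
    (g : EuclideanSpace ℝ (Fin N) → EuclideanSpace ℝ (Fin N)) : Prop :=
  LocallyIntegrableOn u Ω volume ∧ LocallyIntegrableOn g Ω volume ∧
    ∀ φ : EuclideanSpace ℝ (Fin N) → ℝ, IsTestFunction Ω φ →
      ∫ x in Ω, u x • gradient φ x = - ∫ x in Ω, φ x • g x

open Classical in
/-- The weak gradient of `u` on `Ω` (unique up to a null subset of `Ω`), or `0` if there is none. -/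
def weakGrad {N : ℕ} (Ω : Set (EuclideanSpace ℝ (Fin N)))
    (u : EuclideanSpace ℝ (Fin N) → ℝ) :
    EuclideanSpace ℝ (Fin N) → EuclideanSpace ℝ (Fin N) :=
  if h : ∃ g, HasWeakGradient Ω u g then h.choose else 0

/-- Membership in the Sobolev space `W^{1,p}(Ω)`. -/
def MemW1p {N : ℕ} (Ω : Set (EuclideanSpace ℝ (Fin N))) (p : ℝ)
    (u : EuclideanSpace ℝ (Fin N) → ℝ) : Prop :=
  MemLp u (ENNReal.ofReal p) (volume.restrict Ω) ∧
    ∃ g, HasWeakGradient Ω u g ∧ MemLp g (ENNReal.ofReal p) (volume.restrict Ω)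

/-- The space `W_0^{1,p}(Ω)`: the closure of the test functions in `W^{1,p}(Ω)`. -/
def W01p {N : ℕ} (Ω : Set (EuclideanSpace ℝ (Fin N))) (p : ℝ) :
    Set (EuclideanSpace ℝ (Fin N) → ℝ) :=
  {u | MemW1p Ω p u ∧ ∃ φ : ℕ → EuclideanSpace ℝ (Fin N) → ℝ,
    (∀ n, IsTestFunction Ω (φ n)) ∧
    Tendsto (fun n => eLpNorm (fun x => φ n x - u x) (ENNReal.ofReal p) (volume.restrict Ω))
      atTop (𝓝 0) ∧
    Tendsto (fun n => eLpNorm (fun x => gradient (φ n) x - weakGrad Ω u x)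
      (ENNReal.ofReal p) (volume.restrict Ω)) atTop (𝓝 0)}

/-- The norm `‖u‖_W = (∫_Ω |∇u|^p)^{1/p}` on `W_0^{1,p}(Ω)`. -/
def normW {N : ℕ} (Ω : Set (EuclideanSpace ℝ (Fin N))) (p : ℝ)
    (u : EuclideanSpace ℝ (Fin N) → ℝ) : ℝ :=
  (∫ x in Ω, ‖weakGrad Ω u x‖ ^ p) ^ (1 / p)

/-- The `C^1` norm `sup_Ω |u| + sup_Ω |∇u|`, with value `∞` if one of the suprema is infinite. -/
def normC1 {N : ℕ} (Ω : Set (EuclideanSpace ℝ (Fin N)))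
    (u : EuclideanSpace ℝ (Fin N) → ℝ) : ℝ≥0∞ :=
  (⨆ x ∈ Ω, ‖u x‖ₑ) + ⨆ x ∈ Ω, ‖gradient u x‖ₑ

/-- The critical Sobolev exponent `p^* = pN/(N-p)`. -/
def critExp (N : ℕ) (p : ℝ) : ℝ := p * N / (N - p)

/-- `M̂(t) = ∫_0^t M(s) ds`. -/
def MHat (M : ℝ → ℝ) (t : ℝ) : ℝ := ∫ s in (0 : ℝ)..t, M s

/-- `F(x,v) = ∫_0^v f(x,s) ds`. -/
def primF {N : ℕ} (f : EuclideanSpace ℝ (Fin N) → ℝ → ℝ)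
    (x : EuclideanSpace ℝ (Fin N)) (v : ℝ) : ℝ := ∫ s in (0 : ℝ)..v, f x s

/-- The extended-real-valued integral `∫_Ω g = ∫_Ω g⁺ - ∫_Ω g⁻`
(meaningful when one of the two integrals is finite). -/
def extIntegral {N : ℕ} (Ω : Set (EuclideanSpace ℝ (Fin N)))
    (g : EuclideanSpace ℝ (Fin N) → ℝ) : EReal :=
  ((∫⁻ x in Ω, ENNReal.ofReal (g x) : ℝ≥0∞) : EReal) -
    ((∫⁻ x in Ω, ENNReal.ofReal (-g x) : ℝ≥0∞) : EReal)

/-- `J(u) = (1/p) M̂(‖u‖_W^p) - ∫_Ω F(x,u)`. Since `F` is only bounded from above by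
`C (1 + |v|^{p^*})`, the functional takes values in `(-∞, +∞]`. -/
def functionalJ {N : ℕ} (Ω : Set (EuclideanSpace ℝ (Fin N))) (p : ℝ) (M : ℝ → ℝ)
    (f : EuclideanSpace ℝ (Fin N) → ℝ → ℝ) (u : EuclideanSpace ℝ (Fin N) → ℝ) : EReal :=
  ((1 / p * MHat M (normW Ω p u ^ p) : ℝ) : EReal) - extIntegral Ω (fun x => primF f x (u x))

/-- The origin is a local minimum of `J` among the elements of `A`, with closeness to the origin
measured by `nrm`. -/
def OriginIsLocalMin {N : ℕ} (J : (EuclideanSpace ℝ (Fin N) → ℝ) → EReal)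
    (A : Set (EuclideanSpace ℝ (Fin N) → ℝ))
    (nrm : (EuclideanSpace ℝ (Fin N) → ℝ) → ℝ≥0∞) : Prop :=
  ∃ δ : ℝ, 0 < δ ∧ ∀ u ∈ A, nrm u < ENNReal.ofReal δ → J 0 ≤ J u

/-- Local minimality with respect to the `W_0^{1,p}` norm. -/
def LocalMinW {N : ℕ} (Ω : Set (EuclideanSpace ℝ (Fin N))) (p : ℝ)
    (J : (EuclideanSpace ℝ (Fin N) → ℝ) → EReal) : Prop :=
  OriginIsLocalMin J (W01p Ω p) (fun u => ENNReal.ofReal (normW Ω p u))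

/-- Local minimality with respect to the `C^1` norm. -/
def LocalMinC1 {N : ℕ} (Ω : Set (EuclideanSpace ℝ (Fin N))) (p : ℝ)
    (J : (EuclideanSpace ℝ (Fin N) → ℝ) → EReal) : Prop :=
  OriginIsLocalMin J {u | u ∈ W01p Ω p ∧ ContDiffOn ℝ 1 u Ω} (normC1 Ω)

/-- Local minimality with respect to the `L^∞` norm. -/
def LocalMinLinfty {N : ℕ} (Ω : Set (EuclideanSpace ℝ (Fin N))) (p : ℝ)
    (J : (EuclideanSpace ℝ (Fin N) → ℝ) → EReal) : Prop :=
  OriginIsLocalMin J (W01p Ω p) (fun u => eLpNorm u ∞ (volume.restrict Ω))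

end

/-! Negativity near the origin comes from concentration at fixed height. For a bump `ψ`, put `u_ε(x)
= t ψ((x - x₀)/ε)`. The gradient norm scales as `‖u_ε‖_W = L ε^((N-p)/p)` (`normW_rescale`), so it
tends to `0`, and for small `ε` the first term of `J` is at most `C₁ L^r ε^((N-p)r/p)`. The lower
bound on `F` makes the second integral at least `D ε^N`, where `D > 0` once `t` is large, because `ϖ
> q`. Since `r > p^*` means exactly `(N-p)r/p > N`, the second term wins
(`eventually_functionalJ_rescale_neg`).

These functions do not become small in the sup norm. When `u` is uniformly small, `F(x,u) ≤ 0`, so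
`J(u) ≥ 0 = J(0)` as soon as the `M̂` term is nonnegative; this gives the minimality statements. -/

open scoped RealInnerProductSpace Gradient

/-! ### Weak gradients of `C^1` functions -/

section WeakGradient

variable {N : ℕ} {Ω : Set (EuclideanSpace ℝ (Fin N))}

lemma integrable_of_continuousOn_of_compact_support {α F : Type*} [TopologicalSpace α] [T2Space α]
    [MeasurableSpace α] [OpensMeasurableSpace α] [NormedAddCommGroup F]
    {μ : Measure α} [IsFiniteMeasureOnCompacts μ] {U K : Set α} {h : α → F} (hK : IsCompact K)
    (hKU : K ⊆ U) (hc : ContinuousOn h U) (h0 : ∀ x, x ∉ K → h x = 0) : Integrable h μ :=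
  (integrableOn_iff_integrable_of_support_subset
    (fun x hx => by by_contra hn; exact hx (h0 x hn))).1
    ((hc.mono hKU).integrableOn_compact hK)

/-- Fundamental lemma of the calculus of variations, applied to `g₁ - g₂`. It makes the arbitrary
choice in `weakGrad` harmless. -/
lemma HasWeakGradient.ae_eq (hΩ : IsOpen Ω) {u : EuclideanSpace ℝ (Fin N) → ℝ}
    {g₁ g₂ : EuclideanSpace ℝ (Fin N) → EuclideanSpace ℝ (Fin N)}
    (h₁ : HasWeakGradient Ω u g₁) (h₂ : HasWeakGradient Ω u g₂) :
    g₁ =ᵐ[volume.restrict Ω] g₂ := by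
  have hint : ∀ g : EuclideanSpace ℝ (Fin N) → EuclideanSpace ℝ (Fin N),
      LocallyIntegrableOn g Ω volume → ∀ φ : EuclideanSpace ℝ (Fin N) → ℝ, IsTestFunction Ω φ →
      Integrable (fun x => φ x • g x) volume := by
    intro g hg φ hφ
    have hi : IntegrableOn g (tsupport φ) volume :=
      hg.integrableOn_compact_subset hφ.2.2 hφ.2.1
    have h2 : IntegrableOn (fun x => φ x • g x) (tsupport φ) volume :=
      hi.continuousOn_smul hφ.1.continuous.continuousOn hφ.2.1
    refine (integrableOn_iff_integrable_of_support_subset ?_).1 h2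
    intro x hx
    by_contra hn
    exact hx (by simp [image_eq_zero_of_notMem_tsupport hn])
  have key := hΩ.ae_eq_zero_of_integral_contDiff_smul_eq_zero (μ := volume)
    (f := fun x => g₁ x - g₂ x) (h₁.2.1.sub h₂.2.1) (by
      intro φ hφ1 hφ2 hφ3
      have hφ : IsTestFunction Ω φ := ⟨hφ1, hφ2, hφ3⟩
      have e := (h₁.2.2 φ hφ).symm.trans (h₂.2.2 φ hφ)
      have hs : ∀ g : EuclideanSpace ℝ (Fin N) → EuclideanSpace ℝ (Fin N),
          ∫ x in Ω, φ x • g x = ∫ x, φ x • g x := fun g =>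
        setIntegral_eq_integral_of_forall_compl_eq_zero fun x hx => by
          rw [image_eq_zero_of_notMem_tsupport (fun h => hx (hφ3 h)), zero_smul]
      rw [hs, hs, neg_inj] at e
      simp only [smul_sub]
      rw [integral_sub (hint _ h₁.2.1 _ hφ) (hint _ h₂.2.1 _ hφ), e, sub_self])
  rw [Filter.EventuallyEq, ae_restrict_iff' hΩ.measurableSet]
  filter_upwards [key] with x hx hxΩ
  exact sub_eq_zero.1 (hx hxΩ)

lemma continuous_gradient {w : EuclideanSpace ℝ (Fin N) → ℝ} (hw : ContDiff ℝ 1 w) :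
    Continuous (gradient w) :=
  (InnerProductSpace.toDual ℝ _).symm.continuous.comp (hw.continuous_fderiv one_ne_zero)

lemma continuousOn_gradient (hΩ : IsOpen Ω) {w : EuclideanSpace ℝ (Fin N) → ℝ}
    (hw : ContDiffOn ℝ 1 w Ω) : ContinuousOn (gradient w) Ω :=
  (InnerProductSpace.toDual ℝ _).symm.continuous.comp_continuousOn
    (hw.continuousOn_fderiv_of_isOpen hΩ le_rfl)

lemma gradient_eq_zero_of_notMem_tsupport {w : EuclideanSpace ℝ (Fin N) → ℝ}
    {x : EuclideanSpace ℝ (Fin N)} (hx : x ∉ tsupport w) : gradient w x = 0 := by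
  have : fderiv ℝ w x = 0 := image_eq_zero_of_notMem_tsupport
    (fun h => hx (tsupport_fderiv_subset ℝ h))
  simp [gradient, this]

lemma integral_gradient_eq_zero {w : EuclideanSpace ℝ (Fin N) → ℝ} (hw : ContDiff ℝ 1 w)
    (hc : HasCompactSupport w) : ∫ x, gradient w x = 0 := by
  have hi : Integrable (gradient w) volume :=
    (continuous_gradient hw).integrable_of_hasCompactSupport
      (hc.mono' fun x hx => by
        by_contra hn
        exact hx (gradient_eq_zero_of_notMem_tsupport hn))
  -- In each direction `v`, integrate by parts against the constant function `1`.
  refine ext_inner_left ℝ fun v => ?_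
  rw [← integral_inner hi v, inner_zero_right]
  have e : ∀ x, ⟪v, gradient w x⟫ = fderiv ℝ w x v := fun x => by
    rw [real_inner_comm, gradient, InnerProductSpace.toDual_symm_apply]
  simp only [e]
  have hi' : Integrable (fun x => fderiv ℝ w x v) volume := by
    simpa only [e] using hi.const_inner (𝕜 := ℝ) v
  have := integral_mul_fderiv_eq_neg_fderiv_mul_of_integrable (𝕜 := ℝ)
    (μ := (volume : Measure (EuclideanSpace ℝ (Fin N)))) (v := v) (f := fun _ => (1 : ℝ)) (g := w)
    (by simp) (by simpa using hi')
    (by simpa using hw.continuous.integrable_of_hasCompactSupport hc)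
    (fun _ _ => differentiableAt_const _) (fun _ _ => hw.differentiable one_ne_zero _)
  simpa using this

/-- The product `φ u` is `C^1` with compact support, so its gradient has zero integral; the product
rule then gives the identity. -/
lemma hasWeakGradient_of_contDiffOn (hΩ : IsOpen Ω) {u : EuclideanSpace ℝ (Fin N) → ℝ}
    (hu : ContDiffOn ℝ 1 u Ω) : HasWeakGradient Ω u (gradient u) := by
  refine ⟨hu.continuousOn.locallyIntegrableOn hΩ.measurableSet,
    (continuousOn_gradient hΩ hu).locallyIntegrableOn hΩ.measurableSet, fun φ hφ => ?_⟩
  obtain ⟨hφs, hφc, hφΩ⟩ := hφ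
  have hφ1 : ContDiff ℝ 1 φ := hφs.of_le (by exact_mod_cast le_top)
  have hw : ContDiff ℝ 1 (fun x => φ x * u x) := by
    rw [contDiff_iff_contDiffAt]
    intro x
    -- `u` is regular only on `Ω`, but off the support of `φ` the product vanishes locally.
    by_cases hx : x ∈ tsupport φ
    · exact hφ1.contDiffAt.mul (hu.contDiffAt (hΩ.mem_nhds (hφΩ hx)))
    · have : (fun x => φ x * u x) =ᶠ[𝓝 x] fun _ => 0 := by
        filter_upwards [notMem_tsupport_iff_eventuallyEq.1 hx] with y hy
        simp [hy]
      exact contDiffAt_const.congr_of_eventuallyEq this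
  have hwc : HasCompactSupport (fun x => φ x * u x) := hφc.mul_right
  have hz := integral_gradient_eq_zero hw hwc
  have hgr : ∀ x ∈ Ω, gradient (fun x => φ x * u x) x = φ x • gradient u x + u x • gradient φ x := by
    intro x hx
    have h1 : DifferentiableAt ℝ φ x := hφ1.differentiable one_ne_zero x
    have h2 : DifferentiableAt ℝ u x :=
      (hu.contDiffAt (hΩ.mem_nhds hx)).differentiableAt one_ne_zero
    simp only [gradient]
    rw [fderiv_fun_mul h1 h2]
    simp
  rw [← setIntegral_eq_integral_of_forall_compl_eq_zero (s := Ω) (fun x hx =>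
    gradient_eq_zero_of_notMem_tsupport fun h => hx (hφΩ (tsupport_mul_subset_left h))),
    setIntegral_congr_fun hΩ.measurableSet hgr, integral_add] at hz
  · exact eq_neg_of_add_eq_zero_right hz
  · refine (integrable_of_continuousOn_of_compact_support hφc hφΩ
      (hφs.continuous.continuousOn.smul (continuousOn_gradient hΩ hu)) fun x hx => ?_).integrableOn
    simp [image_eq_zero_of_notMem_tsupport hx]
  · refine (integrable_of_continuousOn_of_compact_support hφc hφΩ
      (hu.continuousOn.smul (continuous_gradient hφ1).continuousOn) fun x hx => ?_).integrableOn
    simp [gradient_eq_zero_of_notMem_tsupport hx]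

lemma weakGrad_ae_eq_gradient (hΩ : IsOpen Ω) {u : EuclideanSpace ℝ (Fin N) → ℝ}
    (hu : ContDiffOn ℝ 1 u Ω) : weakGrad Ω u =ᵐ[volume.restrict Ω] gradient u := by
  have h := hasWeakGradient_of_contDiffOn hΩ hu
  have hex : ∃ g, HasWeakGradient Ω u g := ⟨_, h⟩
  rw [weakGrad, dif_pos hex]
  exact hex.choose_spec.ae_eq hΩ h

lemma normW_eq_of_contDiffOn (hΩ : IsOpen Ω) (p : ℝ) {u : EuclideanSpace ℝ (Fin N) → ℝ}
    (hu : ContDiffOn ℝ 1 u Ω) : normW Ω p u = (∫ x in Ω, ‖gradient u x‖ ^ p) ^ (1 / p) := by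
  rw [normW]
  congr 1
  refine integral_congr_ae ?_
  filter_upwards [weakGrad_ae_eq_gradient hΩ hu] with x hx
  rw [hx]

lemma normW_nonneg (p : ℝ) (u : EuclideanSpace ℝ (Fin N) → ℝ) : 0 ≤ normW Ω p u :=
  Real.rpow_nonneg (integral_nonneg fun _ => Real.rpow_nonneg (norm_nonneg _) _) _

lemma normW_zero (hΩ : IsOpen Ω) {p : ℝ} (hp : 0 < p) :
    normW Ω p (0 : EuclideanSpace ℝ (Fin N) → ℝ) = 0 := by
  have h0 : ContDiffOn ℝ 1 (0 : EuclideanSpace ℝ (Fin N) → ℝ) Ω := contDiffOn_const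
  rw [normW_eq_of_contDiffOn hΩ p h0]
  have : ∀ x, gradient (0 : EuclideanSpace ℝ (Fin N) → ℝ) x = 0 := fun x => by
    simp [gradient]
  simp [this, Real.zero_rpow hp.ne', Real.zero_rpow (inv_ne_zero hp.ne')]

lemma IsTestFunction.mem_W01p (hΩ : IsOpen Ω) (p : ℝ) {φ : EuclideanSpace ℝ (Fin N) → ℝ}
    (hφ : IsTestFunction Ω φ) : φ ∈ W01p Ω p := by
  have h1 : ContDiff ℝ 1 φ := hφ.1.of_le (by exact_mod_cast le_top)
  have hgc : HasCompactSupport (gradient φ) := hφ.2.1.mono' fun x hx => by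
    by_contra hn
    exact hx (gradient_eq_zero_of_notMem_tsupport hn)
  refine ⟨⟨(h1.continuous.memLp_of_hasCompactSupport hφ.2.1).restrict _, gradient φ,
    hasWeakGradient_of_contDiffOn hΩ h1.contDiffOn,
    ((continuous_gradient h1).memLp_of_hasCompactSupport hgc).restrict _⟩, fun _ => φ,
    fun _ => hφ, by simp, ?_⟩
  have : eLpNorm (fun x => gradient φ x - weakGrad Ω φ x) (ENNReal.ofReal p)
      (volume.restrict Ω) = 0 := by
    have e : (fun x => gradient φ x - weakGrad Ω φ x) =ᵐ[volume.restrict Ω] 0 := by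
      filter_upwards [weakGrad_ae_eq_gradient hΩ h1.contDiffOn] with x hx
      simp [hx]
    rw [eLpNorm_congr_ae e, eLpNorm_zero]
  simp [this]

end WeakGradient

/-! ### Sign of the functional and minimality in sup norms -/

section Functional

variable {N : ℕ} {Ω : Set (EuclideanSpace ℝ (Fin N))}

/-- Positive and negative parts are compared separately with lower integrals, so `g` need not be
measurable or integrable. -/
lemma integral_le_extIntegral (hΩ : MeasurableSet Ω) {g h : EuclideanSpace ℝ (Fin N) → ℝ}
    (hh : IntegrableOn h Ω volume) (hle : ∀ x ∈ Ω, h x ≤ g x) :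
    ((∫ x in Ω, h x : ℝ) : EReal) ≤ extIntegral Ω g := by
  rw [integral_eq_lintegral_pos_part_sub_lintegral_neg_part hh, EReal.coe_sub, extIntegral]
  have hp : ∫⁻ x in Ω, ENNReal.ofReal (h x) ≠ ⊤ := hh.lintegral_lt_top.ne
  have hn : ∫⁻ x in Ω, ENNReal.ofReal (-h x) ≠ ⊤ := hh.neg.lintegral_lt_top.ne
  rw [EReal.coe_ennreal_toReal hp, EReal.coe_ennreal_toReal hn]
  refine EReal.sub_le_sub ?_ ?_
  · exact_mod_cast setLIntegral_mono' hΩ fun x hx => ENNReal.ofReal_le_ofReal (hle x hx)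
  · exact_mod_cast setLIntegral_mono' hΩ fun x hx =>
      ENNReal.ofReal_le_ofReal (neg_le_neg (hle x hx))

lemma extIntegral_nonpos {g : EuclideanSpace ℝ (Fin N) → ℝ}
    (hg : ∀ᵐ x ∂volume.restrict Ω, g x ≤ 0) : extIntegral Ω g ≤ 0 := by
  have h0 : ∫⁻ x in Ω, ENNReal.ofReal (g x) = 0 := by
    rw [lintegral_congr_ae (g := fun _ => 0)
      (by filter_upwards [hg] with x hx using ENNReal.ofReal_of_nonpos hx), lintegral_zero]
  rw [extIntegral, h0]
  calc _ ≤ (0 : EReal) - 0 := EReal.sub_le_sub (by simp) (EReal.coe_ennreal_nonneg _)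
    _ = 0 := by simp

lemma functionalJ_zero (hΩ : IsOpen Ω) {p : ℝ} (hp : 0 < p) (M : ℝ → ℝ)
    (f : EuclideanSpace ℝ (Fin N) → ℝ → ℝ) : functionalJ Ω p M f 0 = 0 := by
  simp [functionalJ, normW_zero hΩ hp, Real.zero_rpow hp.ne', MHat, extIntegral, primF]

lemma functionalJ_nonneg {p : ℝ} (hp : 0 < p) {M : ℝ → ℝ}
    {f : EuclideanSpace ℝ (Fin N) → ℝ → ℝ} {u : EuclideanSpace ℝ (Fin N) → ℝ}
    (hM : 0 ≤ MHat M (normW Ω p u ^ p))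
    (hF : ∀ᵐ x ∂volume.restrict Ω, primF f x (u x) ≤ 0) : 0 ≤ functionalJ Ω p M f u := by
  rw [functionalJ]
  calc (0 : EReal) = 0 - 0 := by simp
    _ ≤ _ := EReal.sub_le_sub (by exact_mod_cast mul_nonneg (by positivity) hM)
      (extIntegral_nonpos hF)

lemma functionalJ_neg_of_lt (hΩ : MeasurableSet Ω) {p : ℝ} {M : ℝ → ℝ}
    {f : EuclideanSpace ℝ (Fin N) → ℝ → ℝ} {u h : EuclideanSpace ℝ (Fin N) → ℝ}
    (hh : IntegrableOn h Ω volume) (hle : ∀ x ∈ Ω, h x ≤ primF f x (u x))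
    (hlt : 1 / p * MHat M (normW Ω p u ^ p) < ∫ x in Ω, h x) : functionalJ Ω p M f u < 0 := by
  rw [functionalJ]
  refine (EReal.sub_le_sub le_rfl (integral_le_extIntegral hΩ hh hle)).trans_lt ?_
  rw [← EReal.coe_sub]
  exact_mod_cast sub_neg.2 hlt

/-- A gradient bound `δ` on the bounded set `Ω` gives `‖u‖_W^p ≤ δ^p |Ω|`, so the sign of `M̂`
matters only near `0`. -/
lemma localMinC1_of_nonneg (hΩ : IsOpen Ω) (hΩb : Bornology.IsBounded Ω) {p : ℝ} (hp : 0 < p)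
    {M : ℝ → ℝ} {f : EuclideanSpace ℝ (Fin N) → ℝ → ℝ}
    (hM : ∃ δ > 0, ∀ t : ℝ, 0 ≤ t → t < δ → 0 ≤ MHat M t)
    (hF : ∃ δ > 0, ∀ x ∈ Ω, ∀ v : ℝ, |v| < δ → primF f x v ≤ 0) :
    LocalMinC1 Ω p (functionalJ Ω p M f) := by
  obtain ⟨δ₁, hδ₁, hM⟩ := hM
  obtain ⟨δ₂, hδ₂, hF⟩ := hF
  have hlim : Tendsto (fun d : ℝ => d ^ p * volume.real Ω) (𝓝[>] 0) (𝓝 0) := by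
    have : Tendsto (fun d : ℝ => d ^ p * volume.real Ω) (𝓝 0) (𝓝 (0 ^ p * volume.real Ω)) :=
      ((Real.continuousAt_rpow_const 0 p (Or.inr hp.le)).tendsto).mul_const _
    rw [Real.zero_rpow hp.ne', zero_mul] at this
    exact this.mono_left nhdsWithin_le_nhds
  obtain ⟨δ, hδs, hδ2, hδ0⟩ := ((hlim.eventually_lt_const hδ₁).and
    ((eventually_le_nhds hδ₂).filter_mono nhdsWithin_le_nhds |>.and
      self_mem_nhdsWithin)).exists
  have hδ0 : 0 < δ := hδ0
  refine ⟨δ, hδ0, fun u hu hlt => ?_⟩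
  obtain ⟨hu, hu1⟩ := hu
  rw [functionalJ_zero hΩ hp]
  have hsup : ∀ x ∈ Ω, ‖u x‖ₑ < ENNReal.ofReal δ ∧ ‖gradient u x‖ₑ < ENNReal.ofReal δ :=
    fun x hx =>
      ⟨((le_iSup₂ (f := fun x (_ : x ∈ Ω) => ‖u x‖ₑ) x hx).trans le_self_add).trans_lt hlt,
        ((le_iSup₂ (f := fun x (_ : x ∈ Ω) => ‖gradient u x‖ₑ) x hx).trans
          le_add_self).trans_lt hlt⟩
  have hfin : volume Ω < ⊤ := hΩb.measure_lt_top
  refine functionalJ_nonneg hp ?_ ?_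
  · have hI : 0 ≤ ∫ x in Ω, ‖gradient u x‖ ^ p :=
      integral_nonneg fun _ => Real.rpow_nonneg (norm_nonneg _) _
    rw [normW_eq_of_contDiffOn hΩ p hu1, ← Real.rpow_mul hI, one_div_mul_cancel hp.ne',
      Real.rpow_one]
    refine hM _ hI (lt_of_le_of_lt ?_ hδs)
    refine (Real.le_norm_self _).trans (norm_setIntegral_le_of_norm_le_const hfin fun x hx => ?_)
    rw [Real.norm_of_nonneg (Real.rpow_nonneg (norm_nonneg _) _)]
    refine Real.rpow_le_rpow (norm_nonneg _) ?_ hp.le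
    have := (hsup x hx).2
    rw [← ofReal_norm, ENNReal.ofReal_lt_ofReal_iff hδ0] at this
    exact this.le
  · filter_upwards [ae_restrict_mem hΩ.measurableSet] with x hx
    refine hF x hx _ (lt_of_lt_of_le ?_ hδ2)
    have := (hsup x hx).1
    rwa [← ofReal_norm, ENNReal.ofReal_lt_ofReal_iff hδ0] at this

/-- Smallness in `L^∞` does not control `‖u‖_W`, hence the sign condition on `M̂` at every `t ≥ 0`.
-/
lemma localMinLinfty_of_nonneg (hΩ : IsOpen Ω) {p : ℝ} (hp : 0 < p)
    {M : ℝ → ℝ} {f : EuclideanSpace ℝ (Fin N) → ℝ → ℝ}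
    (hM : ∀ t : ℝ, 0 ≤ t → 0 ≤ MHat M t)
    (hF : ∃ δ > 0, ∀ x ∈ Ω, ∀ v : ℝ, |v| < δ → primF f x v ≤ 0) :
    LocalMinLinfty Ω p (functionalJ Ω p M f) := by
  obtain ⟨δ, hδ, hF⟩ := hF
  refine ⟨δ, hδ, fun u _ hlt => ?_⟩
  rw [functionalJ_zero hΩ hp]
  refine functionalJ_nonneg hp (hM _ (Real.rpow_nonneg (normW_nonneg _ _) _)) ?_
  simp only [eLpNorm_exponent_top] at hlt
  filter_upwards [ae_restrict_mem hΩ.measurableSet,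
    enorm_ae_le_eLpNormEssSup u (volume.restrict Ω)] with x hx hxu
  have := hxu.trans_lt hlt
  rw [← ofReal_norm, ENNReal.ofReal_lt_ofReal_iff hδ] at this
  exact hF x hx _ this

end Functional

/-! ### Scaling of concentrating bumps -/

section Concentration

variable {N : ℕ} {Ω : Set (EuclideanSpace ℝ (Fin N))}

lemma setIntegral_comp_rescale {x₀ : EuclideanSpace ℝ (Fin N)} {ε R : ℝ} (hε : 0 < ε)
    (hΩ : Metric.closedBall x₀ (ε * R) ⊆ Ω) {h : EuclideanSpace ℝ (Fin N) → ℝ}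
    (hh : ∀ y, y ∉ Metric.closedBall 0 R → h y = 0) :
    ∫ x in Ω, h (ε⁻¹ • (x - x₀)) = ε ^ (N : ℝ) * ∫ y, h y := by
  rw [setIntegral_eq_integral_of_forall_compl_eq_zero,
    integral_sub_right_eq_self (fun y => h (ε⁻¹ • y)) x₀, Measure.integral_comp_inv_smul_of_nonneg,
    finrank_euclideanSpace_fin, smul_eq_mul, Real.rpow_natCast]
  · exact hε.le
  · intro x hx
    refine hh _ fun hn => hx (hΩ ?_)
    rw [mem_closedBall_zero_iff, norm_smul, norm_inv, Real.norm_of_nonneg hε.le,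
      inv_mul_le_iff₀ hε] at hn
    rwa [mem_closedBall_iff_norm]

lemma gradient_comp_rescale {ψ : EuclideanSpace ℝ (Fin N) → ℝ} (hψ : ContDiff ℝ 1 ψ)
    (x₀ x : EuclideanSpace ℝ (Fin N)) (t ε : ℝ) :
    gradient (fun x => t * ψ (ε⁻¹ • (x - x₀))) x =
      (t * ε⁻¹) • gradient ψ (ε⁻¹ • (x - x₀)) := by
  have h1 : HasFDerivAt (fun x : EuclideanSpace ℝ (Fin N) => ε⁻¹ • (x - x₀))
      (ε⁻¹ • ContinuousLinearMap.id ℝ (EuclideanSpace ℝ (Fin N))) x :=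
    ((hasFDerivAt_id x).sub_const x₀).const_smul ε⁻¹
  have h2 := (((hψ.differentiable one_ne_zero) (ε⁻¹ • (x - x₀))).hasFDerivAt.comp x h1).const_mul t
  have h3 : fderiv ℝ (fun x => t * ψ (ε⁻¹ • (x - x₀))) x =
      (t * ε⁻¹) • fderiv ℝ ψ (ε⁻¹ • (x - x₀)) := by
    rw [show (fun x => t * ψ (ε⁻¹ • (x - x₀))) =
      fun y => t * (ψ ∘ fun x => ε⁻¹ • (x - x₀)) y from rfl, h2.fderiv]
    ext v
    simp [mul_assoc]
  rw [gradient, h3, gradient]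
  simp

lemma isTestFunction_rescale {ψ : EuclideanSpace ℝ (Fin N) → ℝ} (hψ : ContDiff ℝ ∞ ψ)
    {x₀ : EuclideanSpace ℝ (Fin N)} {ε R : ℝ} (t : ℝ) (hε : 0 < ε)
    (hΩ : Metric.closedBall x₀ (ε * R) ⊆ Ω) (h0 : ∀ y, y ∉ Metric.closedBall 0 R → ψ y = 0) :
    IsTestFunction Ω (fun x => t * ψ (ε⁻¹ • (x - x₀))) := by
  have hs : tsupport (fun x => t * ψ (ε⁻¹ • (x - x₀))) ⊆ Metric.closedBall x₀ (ε * R) := by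
    refine closure_minimal (fun x hx => ?_) Metric.isClosed_closedBall
    by_contra hn
    refine hx ?_
    simp only
    rw [h0, mul_zero]
    intro hm
    rw [mem_closedBall_zero_iff, norm_smul, norm_inv, Real.norm_of_nonneg hε.le,
      inv_mul_le_iff₀ hε] at hm
    exact hn (by rwa [mem_closedBall_iff_norm])
  refine ⟨?_, ?_, hs.trans hΩ⟩
  · exact contDiff_const.mul (hψ.comp ((contDiff_id.sub contDiff_const).const_smul _))
  · exact (isCompact_closedBall x₀ (ε * R)).of_isClosed_subset (isClosed_tsupport _) hs

lemma normW_rescale (hΩo : IsOpen Ω) {ψ : EuclideanSpace ℝ (Fin N) → ℝ} (hψ : ContDiff ℝ 1 ψ)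
    {x₀ : EuclideanSpace ℝ (Fin N)} {ε R t p : ℝ} (hp : 0 < p) (ht : 0 ≤ t) (hε : 0 < ε)
    (hΩ : Metric.closedBall x₀ (ε * R) ⊆ Ω) (h0 : ∀ y, y ∉ Metric.closedBall 0 R → ψ y = 0) :
    normW Ω p (fun x => t * ψ (ε⁻¹ • (x - x₀))) =
      t * (∫ y, ‖gradient ψ y‖ ^ p) ^ (1 / p) * ε ^ ((N - p) / p) := by
  have hc : ContDiff ℝ 1 (fun x => t * ψ (ε⁻¹ • (x - x₀))) :=
    contDiff_const.mul (hψ.comp ((contDiff_id.sub contDiff_const).const_smul _))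
  have hts : tsupport ψ ⊆ Metric.closedBall 0 R :=
    closure_minimal (fun x hx => by by_contra hn; exact hx (h0 x hn)) Metric.isClosed_closedBall
  have hI : 0 ≤ ∫ y, ‖gradient ψ y‖ ^ p :=
    integral_nonneg fun _ => Real.rpow_nonneg (norm_nonneg _) _
  have e : ∀ x, ‖gradient (fun x => t * ψ (ε⁻¹ • (x - x₀))) x‖ ^ p =
      (t * ε⁻¹) ^ p * ‖gradient ψ (ε⁻¹ • (x - x₀))‖ ^ p := fun x => by
    rw [gradient_comp_rescale hψ, norm_smul, Real.norm_of_nonneg (by positivity),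
      Real.mul_rpow (by positivity) (norm_nonneg _)]
  rw [normW_eq_of_contDiffOn hΩo p hc.contDiffOn]
  simp only [e]
  rw [integral_const_mul, setIntegral_comp_rescale (h := fun y => ‖gradient ψ y‖ ^ p) hε hΩ
    (fun y hy => by
      simp [gradient_eq_zero_of_notMem_tsupport (fun h => hy (hts h)), Real.zero_rpow hp.ne']),
    Real.mul_rpow (by positivity) (by positivity), Real.mul_rpow (by positivity) hI,
    ← Real.rpow_mul (by positivity), mul_one_div_cancel hp.ne', Real.rpow_one,
    ← Real.rpow_mul hε.le]
  -- The factor `ε⁻¹` comes from the chain rule, the other from the Jacobian `ε^N`.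
  have : ε ^ ((N - p) / p) = ε⁻¹ * ε ^ ((N : ℝ) * (1 / p)) := by
    rw [← Real.rpow_neg_one, ← Real.rpow_add hε]
    congr 1
    field_simp
    ring
  rw [this]
  ring

/-- Along the concentrating profiles `t ψ((x - x₀) / ε)`, `ε → 0⁺`, with a fixed large `t`, the
`W_0^{1,p}` norm tends to zero while the functional is negative. -/
lemma eventually_functionalJ_rescale_neg (hΩo : IsOpen Ω) {p : ℝ} (hp : 0 < p) (hpN : p < N)
    {M : ℝ → ℝ} {f : EuclideanSpace ℝ (Fin N) → ℝ → ℝ} {r ϖ q C₁ C₂ C₃ : ℝ}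
    (hr : critExp N p < r) (hqϖ : q < ϖ) (hq : 0 < q) (hC₂ : 0 < C₂)
    (hM_le : ∃ δ > 0, ∀ s : ℝ, 0 ≤ s → s < δ → 1 / p * MHat M (s ^ p) ≤ C₁ * s ^ r)
    (hF_ge : ∀ x ∈ Ω, ∀ v : ℝ, 0 ≤ v → C₂ * v ^ ϖ - C₃ * v ^ q ≤ primF f x v)
    {x₀ : EuclideanSpace ℝ (Fin N)} (hx₀ : x₀ ∈ Ω)
    (ψ : ContDiffBump (0 : EuclideanSpace ℝ (Fin N))) :
    ∃ t : ℝ, Tendsto (fun ε : ℝ => normW Ω p (fun x => t * ψ (ε⁻¹ • (x - x₀)))) (𝓝[>] 0) (𝓝 0) ∧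
      ∀ᶠ ε : ℝ in 𝓝[>] 0, IsTestFunction Ω (fun x => t * ψ (ε⁻¹ • (x - x₀))) ∧
        functionalJ Ω p M f (fun x => t * ψ (ε⁻¹ • (x - x₀))) < 0 := by
  have hψ1 : ContDiff ℝ 1 ψ := ψ.contDiff
  have h0 : ∀ y, y ∉ Metric.closedBall 0 ψ.rOut → ψ y = 0 := fun y hy =>
    ψ.zero_of_le_dist (not_le.1 hy).le
  have hϖ : 0 < ϖ := hq.trans hqϖ
  have hcont : ∀ a : ℝ, 0 < a → Continuous (fun y => ψ y ^ a) := fun a ha =>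
    ψ.continuous.rpow_const fun _ => Or.inr ha.le
  have hint : ∀ a : ℝ, 0 < a → Integrable (fun y => ψ y ^ a) volume := fun a ha =>
    (hcont a ha).integrable_of_hasCompactSupport (ψ.hasCompactSupport.mono' fun x hx => by
      by_contra hn
      exact hx (by simp [image_eq_zero_of_notMem_tsupport hn, Real.zero_rpow ha.ne']))
  have hA : 0 < ∫ y, ψ y ^ ϖ := by
    refine (hcont ϖ hϖ).integral_pos_of_hasCompactSupport_nonneg_nonzero
      (x := 0) ?_ (fun y => Real.rpow_nonneg ψ.nonneg _) ?_
    · refine ψ.hasCompactSupport.mono' fun x hx => ?_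
      by_contra hn
      exact hx (by simp [image_eq_zero_of_notMem_tsupport hn, Real.zero_rpow hϖ.ne'])
    · exact (Real.rpow_pos_of_pos (ψ.pos_of_mem_ball (Metric.mem_ball_self ψ.rOut_pos)) _).ne'
  -- The condition amounts to a lower bound on `t^(ϖ-q)`, which is unbounded as `t → ∞`.
  obtain ⟨t, ht0, ht⟩ : ∃ t : ℝ, 0 < t ∧
      0 < C₂ * t ^ ϖ * (∫ y, ψ y ^ ϖ) - C₃ * t ^ q * ∫ y, ψ y ^ q := by
    obtain ⟨t, ht, ht0⟩ := (((tendsto_rpow_atTop (sub_pos.2 hqϖ)).eventually_gt_atTop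
      (C₃ * (∫ y, ψ y ^ q) / (C₂ * ∫ y, ψ y ^ ϖ))).and (eventually_gt_atTop 0)).exists
    refine ⟨t, ht0, ?_⟩
    rw [div_lt_iff₀ (mul_pos hC₂ hA)] at ht
    have e : t ^ ϖ = t ^ (ϖ - q) * t ^ q := by rw [← Real.rpow_add ht0, sub_add_cancel]
    have := mul_lt_mul_of_pos_right ht (Real.rpow_pos_of_pos ht0 q)
    rw [e]
    linarith
  set D := C₂ * t ^ ϖ * (∫ y, ψ y ^ ϖ) - C₃ * t ^ q * ∫ y, ψ y ^ q
  set L := t * (∫ y, ‖gradient ψ y‖ ^ p) ^ (1 / p)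
  have hL0 : 0 ≤ L := mul_nonneg ht0.le (Real.rpow_nonneg
    (integral_nonneg fun _ => Real.rpow_nonneg (norm_nonneg _) _) _)
  have hpow : ∀ a : ℝ, 0 < a → Tendsto (fun ε : ℝ => ε ^ a) (𝓝[>] 0) (𝓝 0) := fun a ha => by
    have := (Real.continuousAt_rpow_const 0 a (Or.inr ha.le)).tendsto
    rw [Real.zero_rpow ha.ne'] at this
    exact this.mono_left nhdsWithin_le_nhds
  have hNp : 0 < (N - p : ℝ) := sub_pos.2 hpN
  -- This is `r > p^*` rewritten.
  have hexp : 0 < (N - p) / p * r - N := by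
    rw [critExp, div_lt_iff₀ hNp] at hr
    rw [sub_pos, div_mul_eq_mul_div, lt_div_iff₀ hp]
    linarith
  have hball : ∀ᶠ ε : ℝ in 𝓝[>] 0, Metric.closedBall x₀ (ε * ψ.rOut) ⊆ Ω := by
    obtain ⟨R, hR, hRΩ⟩ := Metric.isOpen_iff.1 hΩo x₀ hx₀
    have : Tendsto (fun ε : ℝ => ε * ψ.rOut) (𝓝[>] 0) (𝓝 0) := by
      have h : Tendsto (fun ε : ℝ => ε * ψ.rOut) (𝓝 0) (𝓝 (0 * ψ.rOut)) :=
        tendsto_id.mul_const _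
      rw [zero_mul] at h
      exact h.mono_left nhdsWithin_le_nhds
    filter_upwards [this.eventually_lt_const hR] with ε hε
    exact (Metric.closedBall_subset_ball hε).trans hRΩ
  have hnorm : ∀ᶠ ε : ℝ in 𝓝[>] 0,
      normW Ω p (fun x => t * ψ (ε⁻¹ • (x - x₀))) = L * ε ^ ((N - p) / p) := by
    filter_upwards [hball, self_mem_nhdsWithin] with ε hε hε0
    exact normW_rescale hΩo hψ1 hp ht0.le hε0 hε h0
  have hlim : Tendsto (fun ε : ℝ => normW Ω p (fun x => t * ψ (ε⁻¹ • (x - x₀)))) (𝓝[>] 0) (𝓝 0) := by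
    refine Tendsto.congr' (hnorm.mono fun _ h => h.symm) ?_
    simpa using (hpow _ (div_pos hNp hp)).const_mul L
  refine ⟨t, hlim, ?_⟩
  obtain ⟨δ, hδ, hM_le⟩ := hM_le
  -- The comparison of the two terms of `J`, after division by `ε^N`.
  have hsmall : ∀ᶠ ε : ℝ in 𝓝[>] 0, C₁ * L ^ r * ε ^ ((N - p) / p * r - N) < D := by
    have := (hpow _ hexp).const_mul (C₁ * L ^ r)
    rw [mul_zero] at this
    exact this.eventually_lt_const ht
  filter_upwards [hball, hnorm, hsmall, hlim.eventually_lt_const hδ, self_mem_nhdsWithin]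
    with ε hε hnε hsε hδε hε0
  have hε0 : 0 < ε := hε0
  have htest : IsTestFunction Ω (fun x => t * ψ (ε⁻¹ • (x - x₀))) :=
    isTestFunction_rescale ψ.contDiff t hε0 hε h0
  refine ⟨htest, ?_⟩
  have hi : ∀ a : ℝ, 0 < a → Integrable (fun x => ψ (ε⁻¹ • (x - x₀)) ^ a) volume := fun a ha =>
    ((hint a ha).comp_smul (inv_ne_zero hε0.ne')).comp_sub_right x₀
  have hs : ∀ a : ℝ, 0 < a →
      ∫ x in Ω, ψ (ε⁻¹ • (x - x₀)) ^ a = ε ^ (N : ℝ) * ∫ y, ψ y ^ a := fun a ha =>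
    setIntegral_comp_rescale (h := fun y => ψ y ^ a) hε0 hε fun y hy => by
      simp [h0 y hy, Real.zero_rpow ha.ne']
  refine functionalJ_neg_of_lt hΩo.measurableSet
    (h := fun x => C₂ * t ^ ϖ * ψ (ε⁻¹ • (x - x₀)) ^ ϖ - C₃ * t ^ q * ψ (ε⁻¹ • (x - x₀)) ^ q)
    (((hi ϖ hϖ).const_mul _).sub ((hi q hq).const_mul _)).integrableOn (fun x hx => ?_) ?_
  · have := hF_ge x hx (t * ψ (ε⁻¹ • (x - x₀))) (mul_nonneg ht0.le ψ.nonneg)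
    rwa [Real.mul_rpow ht0.le ψ.nonneg, Real.mul_rpow ht0.le ψ.nonneg, ← mul_assoc,
      ← mul_assoc] at this
  · rw [integral_sub ((hi ϖ hϖ).const_mul _).integrableOn ((hi q hq).const_mul _).integrableOn,
      integral_const_mul, integral_const_mul, hs ϖ hϖ, hs q hq]
    refine (hM_le _ (normW_nonneg _ _) hδε).trans_lt ?_
    rw [hnε, Real.mul_rpow hL0 (Real.rpow_nonneg hε0.le _), ← Real.rpow_mul hε0.le]
    have e : ε ^ ((N - p) / p * r) = ε ^ ((N - p) / p * r - N) * ε ^ (N : ℝ) := by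
      rw [← Real.rpow_add hε0, sub_add_cancel]
    have := mul_lt_mul_of_pos_right hsε (Real.rpow_pos_of_pos hε0 (N : ℝ))
    rw [e]
    simp only [D] at this
    linarith

end Concentration

theorem theorem2p1 (N : ℕ) (p : ℝ) (hp : 1 < p) (hpN : p < N)
    (Ω : Set (EuclideanSpace ℝ (Fin N)))
    (hΩo : IsOpen Ω) (hΩc : IsConnected Ω) (hΩb : Bornology.IsBounded Ω)
    (M : ℝ → ℝ) (hMc : ContinuousOn M (Set.Ioi 0))
    (hMi : IntegrableAtFilter M (𝓝[>] (0 : ℝ)) volume)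
    (f : EuclideanSpace ℝ (Fin N) → ℝ → ℝ)
    (hfi : ∀ x ∈ Ω, ∀ v : ℝ, IntervalIntegrable (f x) volume 0 v)
    (hFm : ∀ v : ℝ, AEMeasurable (fun x => primF f x v) (volume.restrict Ω))
    (C₀ : ℝ) (hC₀ : 0 < C₀)
    (hF_sub : ∀ x ∈ Ω, ∀ v : ℝ, primF f x v ≤ C₀ * (1 + |v| ^ critExp N p))
    (r ϖ q : ℝ) (hr : critExp N p < r) (hϖ : ϖ ≤ critExp N p) (hqϖ : q < ϖ) (hq : 1 ≤ q)
    (C₁ C₂ C₃ : ℝ) (hC₁ : 0 < C₁) (hC₂ : 0 < C₂) (hC₃ : 0 < C₃)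
    (hM_le : ∃ δ > 0, ∀ s : ℝ, 0 ≤ s → s < δ → 1 / p * MHat M (s ^ p) ≤ C₁ * s ^ r)
    (hF_ge : ∀ x ∈ Ω, ∀ v : ℝ, 0 ≤ v → C₂ * v ^ ϖ - C₃ * v ^ q ≤ primF f x v) :
    (∃ u : ℕ → EuclideanSpace ℝ (Fin N) → ℝ,
      (∀ n, u n ∈ W01p Ω p) ∧
      Tendsto (fun n => normW Ω p (u n)) atTop (𝓝 0) ∧
      ∀ n, functionalJ Ω p M f (u n) < 0) ∧
    ((∃ δ > 0, ∀ t : ℝ, 0 ≤ t → t < δ → 0 ≤ MHat M t) →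
      (∃ δ > 0, ∀ x ∈ Ω, ∀ v : ℝ, |v| < δ → primF f x v ≤ 0) →
      LocalMinC1 Ω p (functionalJ Ω p M f) ∧ ¬ LocalMinW Ω p (functionalJ Ω p M f)) ∧
    ((∀ t : ℝ, 0 ≤ t → 0 ≤ MHat M t) →
      (∃ δ > 0, ∀ x ∈ Ω, ∀ v : ℝ, |v| < δ → primF f x v ≤ 0) →
      LocalMinC1 Ω p (functionalJ Ω p M f) ∧
      LocalMinLinfty Ω p (functionalJ Ω p M f) ∧
      ¬ LocalMinW Ω p (functionalJ Ω p M f)) := by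
  have hp0 : 0 < p := zero_lt_one.trans hp
  have hseq : ∃ u : ℕ → EuclideanSpace ℝ (Fin N) → ℝ, (∀ n, u n ∈ W01p Ω p) ∧
      Tendsto (fun n => normW Ω p (u n)) atTop (𝓝 0) ∧
      ∀ n, functionalJ Ω p M f (u n) < 0 := by
    obtain ⟨x₀, hx₀⟩ := hΩc.nonempty
    obtain ⟨t, hlim, hev⟩ := eventually_functionalJ_rescale_neg hΩo hp0 hpN hr hqϖ
      (zero_lt_one.trans_le hq) hC₂ hM_le hF_ge hx₀ ⟨1, 2, one_pos, one_lt_two⟩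
    have hseq0 : Tendsto (fun n : ℕ => 1 / ((n : ℝ) + 1)) atTop (𝓝[>] 0) :=
      tendsto_nhdsWithin_iff.2 ⟨tendsto_one_div_add_atTop_nhds_zero_nat,
        Eventually.of_forall fun n => Set.mem_Ioi.2 (by positivity)⟩
    -- Negativity holds only for small `ε`; shifting by `n₀` gives it for every index.
    obtain ⟨n₀, hn₀⟩ := eventually_atTop.1 (hseq0.eventually hev)
    exact ⟨fun n x => t * (⟨1, 2, one_pos, one_lt_two⟩ : ContDiffBump (0 : EuclideanSpace ℝ (Fin N)))
      ((1 / (((n + n₀ : ℕ) : ℝ) + 1))⁻¹ • (x - x₀)), fun n => (hn₀ (n + n₀) (by omega)).1.mem_W01p hΩo p,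
      (hlim.comp hseq0).comp (tendsto_add_atTop_nat n₀), fun n => (hn₀ (n + n₀) (by omega)).2⟩
  have hnot : ¬ LocalMinW Ω p (functionalJ Ω p M f) := by
    rintro ⟨δ, hδ, hmin⟩
    obtain ⟨u, hu, hlim, hneg⟩ := hseq
    obtain ⟨n, hn⟩ := (hlim.eventually_lt_const hδ).exists
    have := hmin (u n) (hu n) ((ENNReal.ofReal_lt_ofReal_iff hδ).2 hn)
    rw [functionalJ_zero hΩo hp0] at this
    exact (hneg n).not_ge this
  refine ⟨hseq, fun hM hF => ⟨localMinC1_of_nonneg hΩo hΩb hp0 hM hF, hnot⟩, fun hM hF =>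
    ⟨localMinC1_of_nonneg hΩo hΩb hp0 ⟨1, one_pos, fun t ht _ => hM t ht⟩ hF,
      localMinLinfty_of_nonneg hΩo hp0 hM hF, hnot⟩⟩
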